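/- Let $A,B$ be $n\times n$ complex positive semidefinite (Hermitian) matrices, let $q\in[0,1]$, and put $C(t)=tA+(1-t)B$ for real $t$. For an $n\times n$ complex matrix $M$ all of whose eigenvalues are real, let $\lambda_1(M)\ge\dots\ge\lambda_n(M)$ denote its eigenvalues, counted with algebraic multiplicity, and let $\sigma_1(M)\ge\dots\ge\sigma_n(M)$ denote the singular values of an $n\times n$ complex matrix $M$. Then the matrices $AB$ and $C(q)C(1-q)$ have only real eigenvalues, and for every $k=1,\dots,n$, $$\lambda_k(AB)\le\lambda_k\bigl(C(q)\,C(1-q)\bigr).$$ Equivalently (taking $A=X^*X$, $B=Y^*Y$), for all $n\times n$ complex matrices $X,Y$, the matrix on the right-hand side below has only real eigenvalues, and for every $k=1,\dots,n$, $$\sigma_k^2(XY^*)\le\lambda_k\bigl((qX^*X+(1-q)Y^*Y)\,((1-q)X^*X+qY^*Y)\bigr).$$ -/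

import Mathlib

open scoped Matrix ComplexOrder

noncomputable section

/-- All eigenvalues of the square complex matrix `M` are real. -/
def HasRealEigenvalues {n : ℕ} (M : Matrix (Fin n) (Fin n) ℂ) : Prop :=
  ∀ z ∈ spectrum ℂ M, z.im = 0

/-- An `n × n` complex matrix has exactly `n` eigenvalues, counted with algebraic multiplicity. -/
theorem card_roots_charpoly {n : ℕ} (M : Matrix (Fin n) (Fin n) ℂ) :
    Multiset.card M.charpoly.roots = n := by
  rw [IsAlgClosed.card_roots_eq_natDegree, Matrix.charpoly_natDegree_eq_dim, Fintype.card_fin]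

/-- The (real parts of the) eigenvalues of `M`, counted with algebraic multiplicity and listed in
non-increasing order; the index is zero-based, so `sortedEigenvalues M 0` is the largest one.
This is the usual ordered list of eigenvalues for a matrix all of whose eigenvalues are real. -/
def sortedEigenvalues {n : ℕ} (M : Matrix (Fin n) (Fin n) ℂ) (k : Fin n) : ℝ :=
  ((M.charpoly.roots.map Complex.re).sort (· ≥ ·)).get
    (k.cast (by rw [Multiset.length_sort, Multiset.card_map, card_roots_charpoly]))

/-- The singular values of `M` in non-increasing order, with zero-based index. -/
def sortedSingularValues {n : ℕ} (M : Matrix (Fin n) (Fin n) ℂ) (k : Fin n) : ℝ :=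
  (Matrix.toEuclideanLin M).singularValues k

/-- The convex combination `C(q) = q A + (1 - q) B`. -/
def convComb {n : ℕ} (A B : Matrix (Fin n) (Fin n) ℂ) (q : ℝ) : Matrix (Fin n) (Fin n) ℂ :=
  q • A + (1 - q) • B

end

/-!
Write `A = X Xᴴ`, `C = q A + (1 - q) B` and `D = (1 - q) A + q B = Z Zᴴ`. The matrices `A * B` and
`C * D` have the same characteristic polynomials as the Hermitian matrices `Xᴴ B X` and `Zᴴ C Z`,
so the theorem compares the ordered eigenvalues of two Hermitian matrices.

For `μ > 0` and positive `P`, `Q` consider the quadratic form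
`h_{P,Q}(u, v) = ⟨P u, u⟩ + ⟨Q v, v⟩ - 2 μ Re ⟨u, v⟩`; completing the square shows that its
inertia counts the eigenvalues of `P Q` above `μ²`. In the coordinates `u = x + y`, `v = x - y`, and
with `M = (A + B) / 2`, `K = (A - B) / 2`, `s = 2 q - 1`, the form `h_{C,D}` is twice
`⟨(M - μ) x, x⟩ + 2 s Re ⟨K x, y⟩ + ⟨(M + μ) y, y⟩`, whose minimum over `y` is the value at `x` of
the Schur complement `M - μ - s² K (M + μ)⁻¹ K`. This decreases as `s²` grows, and `s² = 1` is the
form `h_{A,B}`, so `C D` has at least as many eigenvalues above `μ²` as `A B`. The lemma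
`pencil_pos` is this comparison for a single `x`, the condition on `(u, v)` there saying that
`y` is the minimizer for `s = 1`.

If the `k`-th eigenvalue of `C D` were below `μ²` and that of `A B` above it, a dimension count
(`eigenvalues_conj_le`) would give an `x` at which the first form is positive for its minimizing
`y`, while the second form is nonpositive at some point over `x`; this contradicts `pencil_pos`.
-/

/-! ### Comparison of the two quadratic forms -/

/-- Let `(u, v)` be the minimizer of `⟨A u, u⟩ + ⟨B v, v⟩ - 2 μ Re ⟨u, v⟩` among pairs with a given
sum `u + v`; this is what `huv` says. If the minimum is positive, then the form with `A`, `B`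
replaced by the convex combinations `C`, `D` is positive at every pair with the same sum. -/
theorem pencil_pos {E : Type*} [NormedAddCommGroup E] [InnerProductSpace ℂ E]
    [FiniteDimensional ℂ E] {A B C D : E →ₗ[ℂ] E} (hA : A.IsPositive) (hB : B.IsPositive)
    {q μ : ℝ} (hq : q ∈ Set.Icc (0 : ℝ) 1) (hμ : 0 ≤ μ)
    (hC : ∀ v, C v = (q : ℂ) • A v + ((1 - q : ℝ) : ℂ) • B v)
    (hD : ∀ v, D v = ((1 - q : ℝ) : ℂ) • A v + (q : ℂ) • B v) {u v u' v' : E}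
    (huv : A u + (μ : ℂ) • u = B v + (μ : ℂ) • v)
    (hpos : 0 < (inner ℂ (A u) u).re + (inner ℂ (B v) v).re - 2 * μ * (inner ℂ u v).re)
    (hsum : u + v = u' + v') :
    0 < (inner ℂ (C u') u').re + (inner ℂ (D v') v').re - 2 * μ * (inner ℂ u' v').re := by
  obtain ⟨x, y, rfl, rfl⟩ : ∃ x y, u = x + y ∧ v = x - y :=
    ⟨(2⁻¹ : ℂ) • (u + v), (2⁻¹ : ℂ) • (u - v), by module, by module⟩
  obtain ⟨z, rfl⟩ : ∃ z, u' = x + z := ⟨u' - x, by abel⟩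
  obtain rfl : v' = x - z := by
    rw [← sub_eq_iff_eq_add'] at hsum
    rw [← hsum]
    abel
  have symm : ∀ {T : E →ₗ[ℂ] E}, T.IsPositive → ∀ a b : E,
      (inner ℂ (T a) b).re = (inner ℂ (T b) a).re := fun hT a b => by
    rw [hT.isSymmetric a b]
    exact inner_re_symm (𝕜 := ℂ) _ _
  have e1 : (inner ℂ y x).re = (inner ℂ x y).re := inner_re_symm (𝕜 := ℂ) y x
  have e2 : (inner ℂ z x).re = (inner ℂ x z).re := inner_re_symm (𝕜 := ℂ) z x
  have e3 : (inner ℂ z y).re = (inner ℂ y z).re := inner_re_symm (𝕜 := ℂ) z y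
  have hy := congrArg (fun t => (inner ℂ t y).re) huv
  have hz := congrArg (fun t => (inner ℂ t z).re) huv
  have form : ∀ v : E, 0 ≤ (inner ℂ (A v) v).re + (inner ℂ (B v) v).re
      + 2 * μ * (inner ℂ v v).re := fun v => by
    have h1 := hA.re_inner_nonneg_left v
    have h2 := hB.re_inner_nonneg_left v
    have h3 := mul_nonneg hμ (inner_self_nonneg (𝕜 := ℂ) (x := v))
    simp only [RCLike.re_to_complex] at h1 h2 h3
    linarith
  -- With `s = 2 q - 1`, the minimizer for `C`, `D` is `z = s y`. The new value minus the old one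
  -- is the form `2 (M + μ)` at `z - s y` plus `1 - s² = 4 q (1 - q)` times that form at `y`.
  have h1 := form (z - ((2 * q - 1 : ℝ) : ℂ) • y)
  have h2 := mul_nonneg (mul_nonneg hq.1 (sub_nonneg.2 hq.2)) (form y)
  simp only [hC, hD, map_add, map_sub, map_smul, inner_add_left, inner_add_right, inner_sub_left,
    inner_sub_right, inner_smul_left, inner_smul_right, Complex.add_re, Complex.sub_re,
    Complex.conj_ofReal, Complex.re_ofReal_mul, symm hA y x, symm hA z x, symm hA z y, symm hB y x,
    symm hB z x, symm hB z y, e1, e2, e3] at hpos hy hz h1 h2 ⊢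
  refine lt_of_lt_of_le hpos (sub_nonneg.1 ?_)
  refine le_trans (add_nonneg h1 (mul_nonneg (by norm_num : (0 : ℝ) ≤ 4) h2)) (le_of_eq ?_)
  linear_combination 2 * hy - 2 * (2 * q - 1) * hz

/-! ### Ordered eigenvalues and quadratic forms -/

theorem re_inner_apply_self_eq_sum {E : Type*} [NormedAddCommGroup E] [InnerProductSpace ℂ E]
    [FiniteDimensional ℂ E] {n : ℕ} (hn : Module.finrank ℂ E = n) {T : E →ₗ[ℂ] E}
    (hT : T.IsSymmetric) (w : E) :
    (inner ℂ (T w) w).re =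
      ∑ i, hT.eigenvalues hn i * ‖inner ℂ (hT.eigenvectorBasis hn i) w‖ ^ 2 := by
  rw [← (hT.eigenvectorBasis hn).sum_inner_mul_inner (T w) w, Complex.re_sum]
  refine Finset.sum_congr rfl fun i _ => ?_
  rw [hT w, hT.apply_eigenvectorBasis, inner_smul_right, mul_assoc,
    ← inner_conj_symm w, Complex.conj_mul', RCLike.ofReal_eq_complex_ofReal, Complex.re_ofReal_mul,
    ← Complex.ofReal_pow, Complex.ofReal_re]

/-- A vector orthogonal to the eigenvectors after the `k`-th has Rayleigh quotient at least the
`k`-th eigenvalue. -/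
theorem eigenvalue_mul_le_re_inner {E : Type*} [NormedAddCommGroup E] [InnerProductSpace ℂ E]
    [FiniteDimensional ℂ E] {n : ℕ} (hn : Module.finrank ℂ E = n) {T : E →ₗ[ℂ] E}
    (hT : T.IsSymmetric) (k : Fin n) {w : E}
    (hw : ∀ i, k < i → inner ℂ (hT.eigenvectorBasis hn i) w = 0) :
    hT.eigenvalues hn k * ‖w‖ ^ 2 ≤ (inner ℂ (T w) w).re := by
  rw [re_inner_apply_self_eq_sum hn hT, ← (hT.eigenvectorBasis hn).sum_sq_norm_inner_right w,
    Finset.mul_sum]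
  refine Finset.sum_le_sum fun i _ => ?_
  rcases le_or_gt i k with h | h
  · exact mul_le_mul_of_nonneg_right (hT.eigenvalues_antitone hn h) (sq_nonneg _)
  · simp [hw i h]

/-- A vector orthogonal to the eigenvectors before the `k`-th has Rayleigh quotient at most the
`k`-th eigenvalue. -/
theorem re_inner_le_eigenvalue_mul {E : Type*} [NormedAddCommGroup E] [InnerProductSpace ℂ E]
    [FiniteDimensional ℂ E] {n : ℕ} (hn : Module.finrank ℂ E = n) {T : E →ₗ[ℂ] E}
    (hT : T.IsSymmetric) (k : Fin n) {w : E}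
    (hw : ∀ i, i < k → inner ℂ (hT.eigenvectorBasis hn i) w = 0) :
    (inner ℂ (T w) w).re ≤ hT.eigenvalues hn k * ‖w‖ ^ 2 := by
  rw [re_inner_apply_self_eq_sum hn hT, ← (hT.eigenvectorBasis hn).sum_sq_norm_inner_right w,
    Finset.mul_sum]
  refine Finset.sum_le_sum fun i _ => ?_
  rcases lt_or_ge i k with h | h
  · simp [hw i h]
  · exact mul_le_mul_of_nonneg_right (hT.eigenvalues_antitone hn h) (sq_nonneg _)

theorem eq_zero_of_add_smul_eq_zero {E : Type*} [NormedAddCommGroup E] [InnerProductSpace ℂ E]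
    {T : E →ₗ[ℂ] E} (hT : T.IsPositive) {μ : ℝ} (hμ : 0 < μ) {u : E}
    (h : T u + (μ : ℂ) • u = 0) : u = 0 := by
  have h1 := hT.re_inner_nonneg_left u
  rw [eq_neg_of_add_eq_zero_left h, inner_neg_left, inner_smul_left,
    inner_self_eq_norm_sq_to_K] at h1
  have h2 : μ * ‖u‖ ^ 2 ≤ 0 := by
    simpa [← Complex.ofReal_pow] using h1
  have h3 : ‖u‖ ^ 2 ≤ 0 := nonpos_of_mul_nonpos_right h2 hμ
  simpa using le_antisymm h3 (sq_nonneg _)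

/-- The eigenvalue inequality for linear maps, in symmetrized form: the eigenvalues of `A B` with
`A = X X†` are those of `X† B X`, and the eigenvalues of `C D` with `D = Z Z†` those of
`Z† C Z`. -/
theorem eigenvalues_conj_le {E : Type*} [NormedAddCommGroup E] [InnerProductSpace ℂ E]
    [FiniteDimensional ℂ E] {n : ℕ} (hn : Module.finrank ℂ E = n) {B C X Z : E →ₗ[ℂ] E}
    (hB : B.IsPositive) {q : ℝ} (hq : q ∈ Set.Icc (0 : ℝ) 1)
    (hC : ∀ v, C v = (q : ℂ) • X (X.adjoint v) + ((1 - q : ℝ) : ℂ) • B v)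
    (hZ : ∀ v, Z (Z.adjoint v) = ((1 - q : ℝ) : ℂ) • X (X.adjoint v) + (q : ℂ) • B v)
    (h₁ : (X.adjoint ∘ₗ B ∘ₗ X).IsSymmetric) (h₂ : (Z.adjoint ∘ₗ C ∘ₗ Z).IsPositive) (k : Fin n) :
    h₁.eigenvalues hn k ≤ h₂.isSymmetric.eigenvalues hn k := by
  by_contra! hlt
  set l₁ := h₁.eigenvalues hn k
  set l₂ := h₂.isSymmetric.eigenvalues hn k
  have hl₂ : 0 ≤ l₂ := h₂.nonneg_eigenvalues hn k
  obtain ⟨μ, hμ, hμ₁, hμ₂⟩ : ∃ μ : ℝ, 0 < μ ∧ l₂ < μ ^ 2 ∧ μ ^ 2 < l₁ := by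
    refine ⟨√((l₁ + l₂) / 2), Real.sqrt_pos.2 (by linarith), ?_, ?_⟩ <;>
      rw [Real.sq_sqrt (by linarith)] <;> linarith
  have hA : (X ∘ₗ X.adjoint).IsPositive := X.isPositive_self_comp_adjoint
  have hD : (Z ∘ₗ Z.adjoint).IsPositive := Z.isPositive_self_comp_adjoint
  -- Unknowns `(w, u, v)`. The first two coordinates say that `(u, X w)` is the minimizer over its
  -- sum and that `(μ⁻¹ D v, v)` has the same sum; the remaining `n - 1` orthogonality conditions
  -- bound the Rayleigh quotient of `X† B X` at `w` below and that of `Z† C Z` at `Z† v` above.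
  let w' : E × E × E →ₗ[ℂ] E := LinearMap.fst ℂ E (E × E)
  let u' : E × E × E →ₗ[ℂ] E := LinearMap.fst ℂ E E ∘ₗ LinearMap.snd ℂ E (E × E)
  let v' : E × E × E →ₗ[ℂ] E := LinearMap.snd ℂ E E ∘ₗ LinearMap.snd ℂ E (E × E)
  let F : E × E × E →ₗ[ℂ] E × E × ({i : Fin n // i ≠ k} → ℂ) :=
    ((X ∘ₗ X.adjoint + (μ : ℂ) • LinearMap.id) ∘ₗ u' -
        (B + (μ : ℂ) • LinearMap.id) ∘ₗ X ∘ₗ w').prod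
      (((μ : ℂ) • (u' + X ∘ₗ w') - (Z ∘ₗ Z.adjoint + (μ : ℂ) • LinearMap.id) ∘ₗ v').prod
        (LinearMap.pi fun i => if i.1 < k
          then (innerₛₗ ℂ (h₂.isSymmetric.eigenvectorBasis hn i.1)) ∘ₗ Z.adjoint ∘ₗ v'
          else (innerₛₗ ℂ (h₁.eigenvectorBasis hn i.1)) ∘ₗ w'))
  have hker : LinearMap.ker F ≠ ⊥ := by
    refine LinearMap.ker_ne_bot_of_finrank_lt ?_
    have := k.pos
    simp only [Module.finrank_prod, hn, Module.finrank_fintype_fun_eq_card,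
      Fintype.card_subtype_compl, Fintype.card_fin, Fintype.card_subtype_eq]
    omega
  obtain ⟨⟨w, u, v⟩, hF, hne⟩ := (Submodule.ne_bot_iff _).1 hker
  have hF1 : X (X.adjoint u) + (μ : ℂ) • u = B (X w) + (μ : ℂ) • X w :=
    sub_eq_zero.1 congr(($(LinearMap.mem_ker.1 hF)).1)
  have hF2 : (μ : ℂ) • (u + X w) = Z (Z.adjoint v) + (μ : ℂ) • v :=
    sub_eq_zero.1 congr(($(LinearMap.mem_ker.1 hF)).2.1)
  have hF3 : ∀ i : {i : Fin n // i ≠ k}, (if i.1 < k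
          then (innerₛₗ ℂ (h₂.isSymmetric.eigenvectorBasis hn i.1)) ∘ₗ Z.adjoint ∘ₗ v'
          else (innerₛₗ ℂ (h₁.eigenvectorBasis hn i.1)) ∘ₗ w') (w, u, v) = 0 := fun i =>
    congr(($(LinearMap.mem_ker.1 hF)).2.2 i)
  have hw : w ≠ 0 := by
    rintro rfl
    obtain rfl : u = 0 := eq_zero_of_add_smul_eq_zero hA hμ (by simpa using hF1)
    obtain rfl : v = 0 := eq_zero_of_add_smul_eq_zero hD hμ (by simpa using hF2.symm)
    exact hne rfl
  have hlow := eigenvalue_mul_le_re_inner hn h₁ k (w := w) fun i hi => by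
    simpa [hi.not_gt, w'] using hF3 ⟨i, hi.ne'⟩
  have hupp := re_inner_le_eigenvalue_mul hn h₂.isSymmetric k (w := Z.adjoint v) fun i hi => by
    simpa [hi, v'] using hF3 ⟨i, hi.ne⟩
  have hμ' : (μ : ℂ) ≠ 0 := by exact_mod_cast hμ.ne'
  simp only [LinearMap.comp_apply, LinearMap.adjoint_inner_left] at hlow hupp
  have hpos := pencil_pos (D := Z ∘ₗ Z.adjoint) (u' := ((μ⁻¹ : ℝ) : ℂ) • Z (Z.adjoint v))
    (v' := v) hA hB hq hμ.le hC hZ hF1 ?_ ?_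
  · have e : (inner ℂ (Z (Z.adjoint v)) v).re = ‖Z.adjoint v‖ ^ 2 := by
      rw [← LinearMap.adjoint_inner_right, inner_self_eq_norm_sq_to_K]
      simp [← Complex.ofReal_pow]
    simp only [map_smul, inner_smul_left, inner_smul_right, Complex.conj_ofReal,
      Complex.re_ofReal_mul, LinearMap.comp_apply, e] at hpos
    have hle : (inner ℂ (C (Z (Z.adjoint v))) (Z (Z.adjoint v))).re ≤ μ ^ 2 * ‖Z.adjoint v‖ ^ 2 :=
      hupp.trans (mul_le_mul_of_nonneg_right hμ₁.le (sq_nonneg _))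
    have hle' := mul_le_mul_of_nonneg_left hle (sq_nonneg μ⁻¹)
    have hcancel : μ * μ⁻¹ = 1 := mul_inv_cancel₀ hμ.ne'
    have hcancel' : μ⁻¹ ^ 2 * (μ ^ 2 * ‖Z.adjoint v‖ ^ 2) = ‖Z.adjoint v‖ ^ 2 := by
      field_simp
    rw [hcancel'] at hle'
    refine hpos.not_ge ?_
    linear_combination hle' - 2 * ‖Z.adjoint v‖ ^ 2 * hcancel
  · have h := norm_sub_sq (𝕜 := ℂ) (X.adjoint u) ((μ : ℂ) • w)
    have e : (inner ℂ (X (X.adjoint u)) u).re = ‖X.adjoint u‖ ^ 2 := by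
      rw [← LinearMap.adjoint_inner_right, inner_self_eq_norm_sq_to_K]
      simp [← Complex.ofReal_pow]
    have hlt : μ ^ 2 * ‖w‖ ^ 2 < l₁ * ‖w‖ ^ 2 :=
      mul_lt_mul_of_pos_right hμ₂ (pow_pos (norm_pos_iff.2 hw) 2)
    rw [inner_smul_right, LinearMap.adjoint_inner_left, RCLike.re_to_complex,
      Complex.re_ofReal_mul, norm_smul, Complex.norm_real, Real.norm_of_nonneg hμ.le] at h
    rw [LinearMap.comp_apply, e]
    -- Completing the square: `‖X† u‖² - 2 μ Re ⟨u, X w⟩ = ‖X† u - μ w‖² - μ² ‖w‖²`.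
    nlinarith [sq_nonneg ‖X.adjoint u - (μ : ℂ) • w‖]
  · rw [← smul_right_injective E hμ' |>.eq_iff]
    simp only [hF2, smul_add, Complex.ofReal_inv, smul_inv_smul₀ hμ']

/-! ### Products of positive semidefinite matrices -/

theorem sortedEigenvalues_eq {n : ℕ} {M : Matrix (Fin n) (Fin n) ℂ}
    {T : EuclideanSpace ℂ (Fin n) →ₗ[ℂ] EuclideanSpace ℂ (Fin n)} (hT : T.IsSymmetric)
    (h : M.charpoly = T.charpoly) (k : Fin n) :
    sortedEigenvalues M k = hT.eigenvalues finrank_euclideanSpace_fin k := by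
  have hs := hT.sort_roots_charpoly_eq_eigenvalues finrank_euclideanSpace_fin
  rw [← h] at hs
  have hs' : (M.charpoly.roots.map Complex.re).sort (· ≥ ·) = _ := hs
  simp [sortedEigenvalues, hs']

theorem toEuclideanLin_mul {n : ℕ} (M N : Matrix (Fin n) (Fin n) ℂ) :
    Matrix.toEuclideanLin (M * N) = Matrix.toEuclideanLin M ∘ₗ Matrix.toEuclideanLin N :=
  Matrix.toLpLin_mul_same 2 M N

theorem toEuclideanLin_convComb {n : ℕ} (A B : Matrix (Fin n) (Fin n) ℂ) (q : ℝ)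
    (v : EuclideanSpace ℂ (Fin n)) : Matrix.toEuclideanLin (convComb A B q) v =
      (q : ℂ) • Matrix.toEuclideanLin A v + ((1 - q : ℝ) : ℂ) • Matrix.toEuclideanLin B v := by
  have h : convComb A B q = (q : ℂ) • A + ((1 - q : ℝ) : ℂ) • B := rfl
  rw [h, map_add, map_smul, map_smul]
  rfl

theorem charpoly_toEuclideanLin {n : ℕ} (M : Matrix (Fin n) (Fin n) ℂ) :
    (Matrix.toEuclideanLin M).charpoly = M.charpoly :=
  Matrix.charpoly_toLin M (PiLp.basisFun 2 ℂ (Fin n))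

theorem exists_eq_mul_conjTranspose {n : ℕ} {A : Matrix (Fin n) (Fin n) ℂ} (hA : A.PosSemidef) :
    ∃ X : Matrix (Fin n) (Fin n) ℂ, A = X * Xᴴ := by
  open scoped MatrixOrder in
  obtain ⟨Y, rfl⟩ := CStarAlgebra.nonneg_iff_eq_star_mul_self.mp hA.nonneg
  exact ⟨star Y, by simp [Matrix.star_eq_conjTranspose]⟩

theorem charpoly_mul_self_conjTranspose_mul {n : ℕ} (X B : Matrix (Fin n) (Fin n) ℂ) :
    (X * Xᴴ * B).charpoly = (Xᴴ * B * X).charpoly := by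
  rw [mul_assoc, Matrix.charpoly_mul_comm]

theorem hasRealEigenvalues_mul {n : ℕ} {A B : Matrix (Fin n) (Fin n) ℂ} (hA : A.PosSemidef)
    (hB : B.PosSemidef) : HasRealEigenvalues (A * B) := by
  obtain ⟨X, rfl⟩ := exists_eq_mul_conjTranspose hA
  intro z hz
  have hH : (Xᴴ * B * X).IsHermitian := (hB.conjTranspose_mul_mul_same X).isHermitian
  rw [Matrix.mem_spectrum_iff_isRoot_charpoly, charpoly_mul_self_conjTranspose_mul,
    ← Matrix.mem_spectrum_iff_isRoot_charpoly, hH.spectrum_eq_image_range] at hz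
  obtain ⟨_, _, rfl⟩ := hz
  simp

theorem Matrix.PosSemidef.convComb {n : ℕ} {A B : Matrix (Fin n) (Fin n) ℂ} (hA : A.PosSemidef)
    (hB : B.PosSemidef) {q : ℝ} (hq : q ∈ Set.Icc (0 : ℝ) 1) : (convComb A B q).PosSemidef :=
  (hA.smul hq.1).add (hB.smul (sub_nonneg.2 hq.2))

theorem sortedEigenvalues_mul_le {n : ℕ} {A B : Matrix (Fin n) (Fin n) ℂ} (hA : A.PosSemidef)
    (hB : B.PosSemidef) {q : ℝ} (hq : q ∈ Set.Icc (0 : ℝ) 1) (k : Fin n) :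
    sortedEigenvalues (A * B) k ≤ sortedEigenvalues (convComb A B q * convComb A B (1 - q)) k := by
  have hCpos := hA.convComb hB hq
  have hq' : 1 - q ∈ Set.Icc (0 : ℝ) 1 := ⟨sub_nonneg.2 hq.2, sub_le_self _ hq.1⟩
  obtain ⟨X, hX⟩ := exists_eq_mul_conjTranspose hA
  obtain ⟨Z, hZ⟩ := exists_eq_mul_conjTranspose (hA.convComb hB hq')
  have h₁ := (hB.conjTranspose_mul_mul_same X)
  have h₂ := (hCpos.conjTranspose_mul_mul_same Z)
  rw [← Matrix.isPositive_toEuclideanLin_iff, toEuclideanLin_mul, toEuclideanLin_mul,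
    Matrix.toEuclideanLin_conjTranspose_eq_adjoint, LinearMap.comp_assoc] at h₁ h₂
  rw [sortedEigenvalues_eq h₁.isSymmetric, sortedEigenvalues_eq h₂.isSymmetric]
  · refine eigenvalues_conj_le _ (Matrix.isPositive_toEuclideanLin_iff.2 hB) hq (fun v => ?_)
      (fun v => ?_) h₁.isSymmetric h₂ k
    · rw [← LinearMap.comp_apply, ← Matrix.toEuclideanLin_conjTranspose_eq_adjoint,
        ← toEuclideanLin_mul, ← hX, toEuclideanLin_convComb]
    · rw [← LinearMap.comp_apply, ← LinearMap.comp_apply,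
        ← Matrix.toEuclideanLin_conjTranspose_eq_adjoint,
        ← Matrix.toEuclideanLin_conjTranspose_eq_adjoint, ← toEuclideanLin_mul,
        ← toEuclideanLin_mul, ← hX, ← hZ, toEuclideanLin_convComb, sub_sub_cancel]
  · rw [Matrix.charpoly_mul_comm, hZ, charpoly_mul_self_conjTranspose_mul, ← LinearMap.comp_assoc,
      ← Matrix.toEuclideanLin_conjTranspose_eq_adjoint, ← toEuclideanLin_mul,
      ← toEuclideanLin_mul, charpoly_toEuclideanLin]
  · rw [hX, charpoly_mul_self_conjTranspose_mul, ← LinearMap.comp_assoc,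
      ← Matrix.toEuclideanLin_conjTranspose_eq_adjoint, ← toEuclideanLin_mul,
      ← toEuclideanLin_mul, charpoly_toEuclideanLin]

theorem sq_sortedSingularValues_mul_conjTranspose {n : ℕ} (X Y : Matrix (Fin n) (Fin n) ℂ)
    (k : Fin n) : sortedSingularValues (X * Yᴴ) k ^ 2 =
      sortedEigenvalues (Xᴴ * X * (Yᴴ * Y)) k := by
  have hT := (Matrix.toEuclideanLin (X * Yᴴ)).isSymmetric_adjoint_comp_self
  have h := (Matrix.toEuclideanLin (X * Yᴴ)).sq_singularValues_fin
    (finrank_euclideanSpace_fin (𝕜 := ℂ) (n := n)) k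
  refine h.trans (sortedEigenvalues_eq hT ?_ k).symm
  rw [← Matrix.toEuclideanLin_conjTranspose_eq_adjoint, ← toEuclideanLin_mul,
    charpoly_toEuclideanLin, Matrix.conjTranspose_mul, Matrix.conjTranspose_conjTranspose,
    ← mul_assoc (Xᴴ * X), Matrix.charpoly_mul_comm _ Y]
  simp only [mul_assoc]

theorem theorem2 (n : ℕ) (q : ℝ) (hq : q ∈ Set.Icc (0 : ℝ) 1) :
    (∀ A B : Matrix (Fin n) (Fin n) ℂ, A.PosSemidef → B.PosSemidef →
      HasRealEigenvalues (A * B) ∧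
      HasRealEigenvalues (convComb A B q * convComb A B (1 - q)) ∧
      ∀ k : Fin n, sortedEigenvalues (A * B) k ≤
        sortedEigenvalues (convComb A B q * convComb A B (1 - q)) k) ∧
    (∀ X Y : Matrix (Fin n) (Fin n) ℂ,
      HasRealEigenvalues
        ((q • (Xᴴ * X) + (1 - q) • (Yᴴ * Y)) * ((1 - q) • (Xᴴ * X) + q • (Yᴴ * Y))) ∧
      ∀ k : Fin n, sortedSingularValues (X * Yᴴ) k ^ 2 ≤
        sortedEigenvalues
          ((q • (Xᴴ * X) + (1 - q) • (Yᴴ * Y)) * ((1 - q) • (Xᴴ * X) + q • (Yᴴ * Y))) k) := by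
  refine ⟨fun A B hA hB => ⟨hasRealEigenvalues_mul hA hB, ?_, sortedEigenvalues_mul_le hA hB hq⟩,
    fun X Y => ?_⟩
  · exact hasRealEigenvalues_mul (hA.convComb hB hq)
      (hA.convComb hB ⟨sub_nonneg.2 hq.2, sub_le_self _ hq.1⟩)
  · have hA := Matrix.posSemidef_conjTranspose_mul_self X
    have hB := Matrix.posSemidef_conjTranspose_mul_self Y
    have h1 := hasRealEigenvalues_mul (hA.convComb hB hq)
      (hA.convComb hB ⟨sub_nonneg.2 hq.2, sub_le_self _ hq.1⟩)
    have h2 := sortedEigenvalues_mul_le hA hB hq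
    simp only [convComb, sub_sub_cancel] at h1 h2
    exact ⟨h1, fun k => (sq_sortedSingularValues_mul_conjTranspose X Y k).trans_le (h2 k)⟩
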